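/- There is an absolute constant $C$ such that the following holds. Let $S$ be a finite set of $n$ points in $\mathbb{R}^3$, not necessarily in general position, each of which has exactly one color; let $m$ be the number of colors that occur. For an ordering $\chi_1,\dots,\chi_m$ of the colors let $V_i\subseteq S$ be the set of all points that have one of the colors $\chi_1,\dots,\chi_i$ (so $V_0=\emptyset$), and let $\mathcal F_i$ be the set of vertices, edges and facets of the convex hull $\mathrm{CH}(V_i)$, that is, of its nonempty faces of dimension at most $2$ (where a hull of dimension at most $2$ is a face of itself). The number of structural changes to the convex hull caused by inserting the $i$-th color class all at once is $|\mathcal F_{i}\setminus\mathcal F_{i-1}|+|\mathcal F_{i-1}\setminus\mathcal F_{i}|$, the number of faces created or destroyed. If the ordering of the colors is chosen uniformly at random among all $m!$ orderings, then the expected total number of structural changes satisfies $$\mathbb{E}\left[\sum_{i=1}^m\bigl(|\mathcal F_{i}\setminus\mathcal F_{i-1}|+|\mathcal F_{i-1}\setminus\mathcal F_{i}|\bigr)\right]\le C\,n .$$ -/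

import Mathlib

open scoped BigOperators symmDiff

/-- Euclidean 3-space. -/
abbrev Point3 : Type := EuclideanSpace ℝ (Fin 3)

/-- The vertices, edges and facets of the convex hull of `V`: its nonempty faces (intersections
with a supporting plane, or the hull itself) of dimension `0`, `1` or `2`. If `V` lies in a plane
but not on a line, the polygon `convexHull ℝ V` is itself a facet; if `V` is three-dimensional,
the hull itself is not counted. -/
def hullFaces (V : Set Point3) : Set (Set Point3) :=
  {F | F.Nonempty ∧ IsExposed ℝ (convexHull ℝ V) F ∧ Module.finrank ℝ (vectorSpan ℝ F) ≤ 2}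

/-- A finite set has finitely many hull faces, so that counting them with `Set.ncard` is
meaningful. -/
theorem hullFaces_finite {V : Set Point3} (hV : V.Finite) : (hullFaces V).Finite := by
  refine (hV.finite_subsets.image (fun T : Set Point3 => convexHull ℝ T)).subset ?_
  rintro F ⟨-, hF, -⟩
  have hc : Convex ℝ F := hF.convex (convex_convexHull ℝ V)
  refine ⟨F ∩ V, Set.inter_subset_right, ?_⟩
  have hcomp : IsCompact F := hF.isCompact (Set.Finite.isCompact_convexHull (𝕜 := ℝ) hV)
  refine Set.Subset.antisymm (convexHull_min Set.inter_subset_left hc) ?_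
  have hsub : F.extremePoints ℝ ⊆ F ∩ V := fun x hx =>
    ⟨hx.1, extremePoints_convexHull_subset (hF.isExtreme.extremePoints_subset_extremePoints hx)⟩
  calc F = closure (convexHull ℝ (F.extremePoints ℝ)) :=
        (closure_convexHull_extremePoints hcomp hc).symm
    _ ⊆ convexHull ℝ (F ∩ V) := closure_minimal (convexHull_mono hsub)
        (Set.Finite.isClosed_convexHull (𝕜 := ℝ) (hV.subset Set.inter_subset_right))

/-- The points of the first `i` colors in the order `σ`, where `σ j` is the `j`-th color
(counting from `0`). -/
def pointsOfFirstColors {m : ℕ} (S : Finset Point3) (color : S → Fin m)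
    (σ : Equiv.Perm (Fin m)) (i : ℕ) : Set Point3 :=
  {p | ∃ h : p ∈ S, ∃ j : Fin m, (j : ℕ) < i ∧ σ j = color ⟨p, h⟩}

/-- The number of structural changes to the convex hull when the color class of `σ i` is inserted
all at once: the number of vertices, edges and facets that are created or destroyed. -/
noncomputable def structuralChangesAt {m : ℕ} (S : Finset Point3) (color : S → Fin m)
    (σ : Equiv.Perm (Fin m)) (i : ℕ) : ℕ :=
  (hullFaces (pointsOfFirstColors S color σ i) ∆
    hullFaces (pointsOfFirstColors S color σ (i + 1))).ncard

/-- The total number of structural changes over all `m` insertions of color classes. -/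
noncomputable def totalStructuralChanges {m : ℕ} (S : Finset Point3) (color : S → Fin m)
    (σ : Equiv.Perm (Fin m)) : ℕ :=
  ∑ i ∈ Finset.range m, structuralChangesAt S color σ i

/-- The expectation of the total number of structural changes, for an order of the color classes
chosen uniformly at random. -/
noncomputable def expectedStructuralChanges {m : ℕ} (S : Finset Point3) (color : S → Fin m) : ℝ :=
  𝔼 σ : Equiv.Perm (Fin m), (totalStructuralChanges S color σ : ℝ)

/-! The sequence of face sets starts empty, so at most as many faces are destroyed as are created,
and it suffices to count creations. A face with only old vertices was already a face before the
insertion, so each created face has a vertex of the newly inserted color. Creations are thus bounded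
by the face-vertex incidences whose vertex has the last color.

Backwards analysis bounds these. Given the set of the first `i + 1` colors, the last one is uniform
among them, so its expected share of the incidences is a fraction `1 / (i + 1)`. A hull on `N`
points has at most `20 * N` incidences, and by the same symmetry the expected number of points in
the first `i + 1` classes is `i + 1` times the expected size of the last class. Step `i` therefore
creates at most 20 times the expected size of its class; class sizes add up to `n`, and the factor 2
for destructions gives 40.

The incidence bound avoids Euler's formula. Take a linear functional that separates the points. In a
facet all vertices but two are non-extremal for it, and each vertex is non-extremal in at most two
facets, because the level plane through it cuts such facets in edges of a planar section. Edges are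
charged to facets containing them. -/

/-! ### A sign obstruction in the plane -/

/-- Applying `l j` to a linear dependence of the three vectors kills the `j`-th term and forces the
other two coefficients to have opposite signs or both vanish. Three reals cannot have pairwise
opposite signs. Both "at most two" counts below reduce to this. -/
theorem not_three_vectors_of_finrank_le_two {E : Type*} [AddCommGroup E] [Module ℝ E]
    (L : Submodule ℝ E) [FiniteDimensional ℝ L] (hL : Module.finrank ℝ L ≤ 2) (p : Fin 3 → E)
    (hp : ∀ i, p i ∈ L) (l : Fin 3 → E →ₗ[ℝ] ℝ) (h0 : ∀ i, l i (p i) = 0)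
    (hneg : ∀ i j, i ≠ j → l j (p i) < 0) : False := by
  have hdep : ¬ LinearIndependent ℝ (fun i => (⟨p i, hp i⟩ : L)) := fun h => by
    have := h.fintype_card_le_finrank
    simp only [Fintype.card_fin] at this
    omega
  obtain ⟨g, hg, i, hi⟩ := Fintype.not_linearIndependent_iff.1 hdep
  have hg' : ∑ i, g i • p i = 0 := by
    have := congrArg (Subtype.val : L → E) hg
    simpa using this
  have key : ∀ j, ∑ i, g i * l j (p i) = 0 := fun j => by
    have := congrArg (l j) hg'
    simpa using this
  have k0 := key 0
  have k1 := key 1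
  have k2 := key 2
  simp only [Fin.sum_univ_three, h0, mul_zero, zero_add, add_zero] at k0 k1 k2
  have opp : ∀ {a b s t : ℝ}, s < 0 → t < 0 → a * s + b * t = 0 → a * b ≤ 0 ∧ (a = 0 → b = 0) := by
    intro a b s t hs ht h
    refine ⟨?_, fun ha => ?_⟩
    · by_contra! hab
      rcases pos_and_pos_or_neg_and_neg_of_mul_pos hab with ⟨ha, hb⟩ | ⟨ha, hb⟩
      · linarith [mul_neg_of_pos_of_neg ha hs, mul_neg_of_pos_of_neg hb ht]
      · linarith [mul_pos_of_neg_of_neg ha hs, mul_pos_of_neg_of_neg hb ht]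
    · rw [ha, zero_mul, zero_add] at h
      exact (mul_eq_zero.1 h).resolve_right ht.ne
  obtain ⟨a12, b12⟩ := opp (hneg 1 0 (by decide)) (hneg 2 0 (by decide)) k0
  obtain ⟨a02, b02⟩ := opp (hneg 0 1 (by decide)) (hneg 2 1 (by decide)) k1
  obtain ⟨a01, b01⟩ := opp (hneg 0 2 (by decide)) (hneg 1 2 (by decide)) k2
  obtain ⟨-, b21⟩ := opp (hneg 2 0 (by decide)) (hneg 1 0 (by decide))
    ((add_comm _ _).trans k0)
  obtain ⟨-, b10⟩ := opp (hneg 1 2 (by decide)) (hneg 0 2 (by decide))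
    ((add_comm _ _).trans k2)
  -- Otherwise all three pairwise products are negative, yet the product of the first two is `g 0 ^
  -- 2 * (g 1 * g 2)`.
  have hz : g 0 = 0 := by
    by_contra h
    have h1 : g 1 ≠ 0 := fun h' => h (b10 h')
    have h2 : g 2 ≠ 0 := fun h' => h1 (b21 h')
    have e01 := lt_of_le_of_ne a01 (mul_ne_zero h h1)
    have e02 := lt_of_le_of_ne a02 (mul_ne_zero h h2)
    have e12 := lt_of_le_of_ne a12 (mul_ne_zero h1 h2)
    have := mul_pos_of_neg_of_neg e01 e02
    nlinarith [sq_nonneg (g 0)]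
  fin_cases i
  · exact hi hz
  · exact hi (b01 hz)
  · exact hi (b02 hz)

/-! ### Exposed faces: rigidity, local counts, rotation to a facet, survival under deletion -/

section ExposedFaces

variable {E : Type*} [NormedAddCommGroup E] [NormedSpace ℝ E]

/-- A linear functional that is maximal on `A` exactly at the points of `F`. -/
theorem IsExposed.exists_support {A F : Set E} (hF : IsExposed ℝ A F) {v : E} (hv : v ∈ F) :
    ∃ l : E →ₗ[ℝ] ℝ, (∀ x ∈ F, l (x - v) = 0) ∧ (∀ x ∈ A, l (x - v) ≤ 0) ∧
      ∀ x ∈ A, l (x - v) = 0 → x ∈ F := by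
  obtain ⟨l, rfl⟩ := hF ⟨v, hv⟩
  refine ⟨l, fun x hx => ?_, fun x hx => ?_, fun x hx h => ⟨hx, fun y hy => ?_⟩⟩
  · have h1 := hx.2 v hv.1
    have h2 := hv.2 x hx.1
    simp only [map_sub, ContinuousLinearMap.coe_coe]
    linarith
  · have h2 := hv.2 x hx
    simp only [map_sub, ContinuousLinearMap.coe_coe]
    linarith
  · have h2 := hv.2 y hy
    simp only [map_sub, ContinuousLinearMap.coe_coe] at h
    linarith

/-- A functional supporting `F` is constant on `T`, hence on everything in the affine span of `T`,
which by the rank hypothesis contains `G`. -/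
theorem IsExposed.subset_of_vectorSpan [FiniteDimensional ℝ E] {A F G T : Set E}
    (hF : IsExposed ℝ A F) (hG : IsExposed ℝ A G) (hTF : T ⊆ F) (hTG : T ⊆ G) (hT : T.Nonempty)
    (hr : Module.finrank ℝ (vectorSpan ℝ G) ≤ Module.finrank ℝ (vectorSpan ℝ T)) : G ⊆ F := by
  obtain ⟨t, ht⟩ := hT
  obtain ⟨l, hl, -, hl'⟩ := hF.exists_support (hTF ht)
  have heq : vectorSpan ℝ T = vectorSpan ℝ G :=
    Submodule.eq_of_le_of_finrank_le (vectorSpan_mono ℝ hTG) hr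
  have hker : vectorSpan ℝ T ≤ LinearMap.ker l := by
    rw [vectorSpan_eq_span_vsub_set_right ℝ ht, Submodule.span_le]
    rintro _ ⟨x, hx, rfl⟩
    exact hl x (hTF hx)
  intro x hx
  refine hl' x (hG.subset hx) (hker ?_)
  rw [heq]
  exact vsub_mem_vectorSpan ℝ hx (hTG ht)

theorem IsExposed.eq_of_vectorSpan [FiniteDimensional ℝ E] {A F G T : Set E}
    (hF : IsExposed ℝ A F) (hG : IsExposed ℝ A G) (hTF : T ⊆ F) (hTG : T ⊆ G) (hT : T.Nonempty)
    (hrF : Module.finrank ℝ (vectorSpan ℝ F) ≤ Module.finrank ℝ (vectorSpan ℝ T))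
    (hrG : Module.finrank ℝ (vectorSpan ℝ G) ≤ Module.finrank ℝ (vectorSpan ℝ T)) : F = G :=
  (hG.subset_of_vectorSpan hF hTG hTF hT hrF).antisymm
    (hF.subset_of_vectorSpan hG hTF hTG hT hrG)

theorem IsExposed.eq_of_subset [FiniteDimensional ℝ E] {A F G : Set E} (hF : IsExposed ℝ A F)
    (hG : IsExposed ℝ A G) (hFG : F ⊆ G) (hne : F.Nonempty)
    (hr : Module.finrank ℝ (vectorSpan ℝ G) ≤ Module.finrank ℝ (vectorSpan ℝ F)) : F = G :=
  hF.eq_of_vectorSpan hG subset_rfl hFG hne le_rfl hr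

theorem one_le_finrank_vectorSpan_pair {v q : E} (h : q ≠ v) :
    1 ≤ Module.finrank ℝ (vectorSpan ℝ ({v, q} : Set E)) := by
  rw [Nat.one_le_iff_ne_zero, Ne, Submodule.finrank_eq_zero]
  intro h0
  have := vsub_mem_vectorSpan ℝ (show q ∈ ({v, q} : Set E) by simp)
    (show v ∈ ({v, q} : Set E) by simp)
  rw [h0, Submodule.mem_bot, vsub_eq_sub, sub_eq_zero] at this
  exact h this

theorem exists_ne_of_finrank_vectorSpan {F : Set E} (v : E)
    (h : 1 ≤ Module.finrank ℝ (vectorSpan ℝ F)) : ∃ q ∈ F, q ≠ v := by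
  by_contra! hF
  have : F ⊆ {v} := hF
  have h0 : vectorSpan ℝ F = ⊥ :=
    vectorSpan_of_subsingleton ℝ (Set.subsingleton_singleton.anti this)
  rw [h0, finrank_bot] at h
  omega

/-- At most two edges of a two-dimensional face meet at a point of that face. -/
theorem not_three_edges_in_plane [FiniteDimensional ℝ E] {A G : Set E}
    (hG : Module.finrank ℝ (vectorSpan ℝ G) ≤ 2)
    {v : E} (e : Fin 3 → Set E) (he : ∀ i, IsExposed ℝ A (e i))
    (hr : ∀ i, Module.finrank ℝ (vectorSpan ℝ (e i)) = 1) (hv : ∀ i, v ∈ e i)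
    (hsub : ∀ i, e i ⊆ G) (hne : ∀ i j, i ≠ j → e i ≠ e j) : False := by
  choose q hq hqv using fun i => exists_ne_of_finrank_vectorSpan v (hr i).ge
  choose l hl hl1 hl2 using fun i => (he i).exists_support (hv i)
  refine not_three_vectors_of_finrank_le_two (vectorSpan ℝ G) hG (fun i => q i - v)
    (fun i => vsub_mem_vectorSpan ℝ (hsub i (hq i)) (hsub i (hv i))) l
    (fun i => hl i _ (hq i)) fun i j hij => lt_of_le_of_ne (hl1 j _ ((he i).subset (hq i))) ?_
  intro h0
  have hqj := hl2 j _ ((he i).subset (hq i)) h0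
  have h1 := one_le_finrank_vectorSpan_pair (hqv i)
  refine hne i j hij ((he i).eq_of_vectorSpan (he j) (T := {v, q i}) ?_ ?_ ⟨v, by simp⟩
    ((hr i).trans_le h1) ((hr j).trans_le h1))
  · rintro x (rfl | rfl)
    exacts [hv i, hq i]
  · rintro x (rfl | rfl)
    exacts [hv j, hqj]

/-- If the points were collinear, `x` would place `v` strictly between `a` and `b`, against
extremality. -/
theorem two_le_finrank_vectorSpan_triple {A : Set E} {v a b : E} (x : E →ₗ[ℝ] ℝ)
    (hv : v ∈ A.extremePoints ℝ) (ha : a ∈ A) (hb : b ∈ A) (hav : x a < x v) (hvb : x v < x b) :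
    2 ≤ Module.finrank ℝ (vectorSpan ℝ ({v, a, b} : Set E)) := by
  by_contra! h
  have hc : Collinear ℝ ({v, a, b} : Set E) := collinear_iff_finrank_le_one.2 (by omega)
  obtain ⟨d, hd⟩ := (collinear_iff_of_mem (k := ℝ) (p₀ := v) (by simp)).1 hc
  obtain ⟨r, hr⟩ := hd a (by simp)
  obtain ⟨s, hs⟩ := hd b (by simp)
  simp only [vadd_eq_add] at hr hs
  have e1 : x a = r * x d + x v := by rw [hr]; simp
  have e2 : x b = s * x d + x v := by rw [hs]; simp
  have h1 : r * x d < 0 := by linarith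
  have h2 : 0 < s * x d := by linarith
  have hsr : s * x d - r * x d ≠ 0 := by linarith
  have hxd : x d ≠ 0 := fun h => by simp [h] at h1
  have hav' : a = v := by
    have e3 : s * x d / (s * x d - r * x d) + -(r * x d) / (s * x d - r * x d) = 1 := by
      rw [← add_div, ← sub_eq_add_neg, div_self hsr]
    refine hv.2 ha hb ⟨s * x d / (s * x d - r * x d), -(r * x d) / (s * x d - r * x d),
      div_pos h2 (by linarith), div_pos (by linarith) (by linarith), e3, ?_⟩
    · rw [hr, hs]
      have e4 : s * x d / (s * x d - r * x d) * r + -(r * x d) / (s * x d - r * x d) * s = 0 := by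
        ring
      calc _ = (s * x d / (s * x d - r * x d) * r + -(r * x d) / (s * x d - r * x d) * s) • d
            + (s * x d / (s * x d - r * x d) + -(r * x d) / (s * x d - r * x d)) • v := by module
        _ = v := by rw [e3, e4]; simp
  rw [hav'] at hav
  exact lt_irrefl _ hav

theorem exists_mem_openSegment_map_eq {a b : E} (x : E →ₗ[ℝ] ℝ) {c : ℝ} (ha : x a < c)
    (hb : c < x b) : ∃ p ∈ openSegment ℝ a b, x p = c := by
  have h : x b - x a ≠ 0 := by linarith
  refine ⟨((x b - c) / (x b - x a)) • a + ((c - x a) / (x b - x a)) • b,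
    ⟨_, _, div_pos (by linarith) (by linarith), div_pos (by linarith) (by linarith), ?_, rfl⟩, ?_⟩
  · field_simp
    ring
  · simp only [map_add, map_smul, smul_eq_mul]
    field_simp
    ring

/-- In a three-dimensional space, a vertex of a convex set is non-extremal for a given linear
functional in at most two facets. -/
theorem not_three_facets_nonextremal [FiniteDimensional ℝ E] {A : Set E} (hA : Convex ℝ A) {v : E}
    (hv : v ∈ A.extremePoints ℝ) (x : E →ₗ[ℝ] ℝ) (hx : Module.finrank ℝ (LinearMap.ker x) ≤ 2)
    (F : Fin 3 → Set E) (hF : ∀ i, IsExposed ℝ A (F i))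
    (hr : ∀ i, Module.finrank ℝ (vectorSpan ℝ (F i)) = 2) (hvF : ∀ i, v ∈ F i)
    (hlo : ∀ i, ∃ a ∈ F i, x a < x v) (hhi : ∀ i, ∃ b ∈ F i, x v < x b)
    (hne : ∀ i j, i ≠ j → F i ≠ F j) : False := by
  choose a ha hav using hlo
  choose b hb hvb using hhi
  choose l hl hl1 hl2 using fun i => (hF i).exists_support (hvF i)
  choose p hp hpx using fun i => exists_mem_openSegment_map_eq x (hav i) (hvb i)
  have hpF : ∀ i, p i ∈ F i := fun i =>
    ((hF i).convex hA).openSegment_subset (ha i) (hb i) (hp i)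
  refine not_three_vectors_of_finrank_le_two (LinearMap.ker x) hx (fun i => p i - v)
    (fun i => by simp [hpx]) l
    (fun i => hl i _ (hpF i)) fun i j hij => lt_of_le_of_ne (hl1 j _ ((hF i).subset (hpF i))) ?_
  intro h0
  have hpj := hl2 j _ ((hF i).subset (hpF i)) h0
  have haA := (hF i).subset (ha i)
  have hbA := (hF i).subset (hb i)
  -- `p i` is interior to the segment from `a i` to `b i`, so a face containing `p i` contains both
  -- ends; with `v` these span the plane of the facet.
  have haj : a i ∈ F j := (hF j).isExtreme.2 haA hbA hpj (hp i)
  have hbj : b i ∈ F j := (hF j).isExtreme.2 hbA haA hpj (by rw [openSegment_symm]; exact hp i)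
  have h2 := two_le_finrank_vectorSpan_triple x hv haA hbA (hav i) (hvb i)
  refine hne i j hij ((hF i).eq_of_vectorSpan (hF j) (T := {v, a i, b i}) ?_ ?_ ⟨v, by simp⟩
    ((hr i).trans_le h2) ((hr j).trans_le h2))
  · rintro y (rfl | rfl | rfl)
    exacts [hvF i, ha i, hb i]
  · rintro y (rfl | rfl | rfl)
    exacts [hvF j, haj, hbj]

theorem finrank_ker_of_ne_zero [FiniteDimensional ℝ E] (l : E →ₗ[ℝ] ℝ) {w : E} (hw : l w ≠ 0) :
    Module.finrank ℝ (LinearMap.ker l) + 1 = Module.finrank ℝ E := by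
  have h := l.finrank_range_add_finrank_ker
  have hs : LinearMap.range l = ⊤ := by
    rw [LinearMap.range_eq_top]
    exact LinearMap.surjective fun h0 => hw (by simp [h0])
  rw [hs, finrank_top, Module.finrank_self] at h
  omega

/-- Supplies the direction in which to tilt a supporting plane `l` about the line spanned by `d`,
towards `u`. The vector `w` certifies that `l + t • l'` is nonzero for every `t ≠ 0`. -/
theorem exists_rotation_functional [FiniteDimensional ℝ E] (hE : Module.finrank ℝ E = 3)
    (l : E →ₗ[ℝ] ℝ) {d u : E} (hd : l d = 0) (hu : l u < 0) :
    ∃ l' : E →ₗ[ℝ] ℝ, ∃ w, l' d = 0 ∧ l w = 0 ∧ l' w ≠ 0 ∧ 0 < l' u := by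
  have hk := finrank_ker_of_ne_zero l hu.ne
  have hlt : Module.finrank ℝ (Submodule.span ℝ {d}) < Module.finrank ℝ (LinearMap.ker l) := by
    have := finrank_span_le_card (R := ℝ) ({d} : Set E)
    rw [Set.toFinset_singleton, Finset.card_singleton] at this
    omega
  obtain ⟨w, hw, hwd⟩ : ∃ w ∈ LinearMap.ker l, w ∉ Submodule.span ℝ {d} := by
    by_contra! h
    exact absurd (Submodule.finrank_mono (show LinearMap.ker l ≤ Submodule.span ℝ {d} from h))
      (by omega)
  obtain ⟨f, hfw, hf⟩ := Submodule.exists_le_ker_of_notMem hwd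
  have hfd : f d = 0 := hf (Submodule.mem_span_singleton_self d)
  have hlw : l w = 0 := hw
  rcases lt_trichotomy (f u) 0 with h | h | h
  · exact ⟨-f, w, by simp [hfd], hlw, by simpa using hfw, by simpa using h⟩
  · exact ⟨f - l, w, by simp [hfd, hd], hlw, by simpa [hlw] using hfw, by simpa [h] using hu⟩
  · exact ⟨f, w, hfd, hlw, hfw, h⟩

theorem map_le_of_mem_convexHull {V : Set E} (m : E →ₗ[ℝ] ℝ) {c : ℝ} (h : ∀ y ∈ V, m y ≤ c) {y : E}
    (hy : y ∈ convexHull ℝ V) : m y ≤ c :=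
  convexHull_min (t := {y | m y ≤ c}) h (convex_halfSpace_le m.isLinear c) hy

theorem exposed_of_linear [FiniteDimensional ℝ E] {A : Set E} (m : E →ₗ[ℝ] ℝ) :
    IsExposed ℝ A {x ∈ A | ∀ y ∈ A, m y ≤ m x} := fun _ =>
  ⟨LinearMap.toContinuousLinearMap m, by simp⟩

/-- In dimension three, every edge that is not the entire hull lies in a two-dimensional face. -/
theorem exists_facet_of_edge [FiniteDimensional ℝ E] (hE : Module.finrank ℝ E = 3) {V : Set E}
    (hV : V.Finite)
    {e : Set E} (he : IsExposed ℝ (convexHull ℝ V) e) (hr : Module.finrank ℝ (vectorSpan ℝ e) = 1)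
    (hne : e ≠ convexHull ℝ V) :
    ∃ G, IsExposed ℝ (convexHull ℝ V) G ∧ Module.finrank ℝ (vectorSpan ℝ G) = 2 ∧ e ⊆ G := by
  classical
  have hspan : vectorSpan ℝ e ≠ ⊥ := fun h => by
    rw [h, finrank_bot] at hr
    omega
  obtain ⟨v, hv⟩ : e.Nonempty := by
    by_contra! h
    exact hspan (by simp [h])
  obtain ⟨q, hq, hqv⟩ := exists_ne_of_finrank_vectorSpan v hr.ge
  obtain ⟨l, hl, hl1, hl2⟩ := he.exists_support hv
  have hvV := he.subset hv
  have hsp : vectorSpan ℝ e ≤ Submodule.span ℝ {q - v} := by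
    refine (Submodule.eq_of_le_of_finrank_le ?_ ?_).ge
    · rw [Submodule.span_singleton_le_iff_mem]
      exact vsub_mem_vectorSpan ℝ hq hv
    · rw [hr, finrank_span_singleton (sub_ne_zero.2 hqv)]
  obtain ⟨u, huV, hu⟩ : ∃ u ∈ V, l (u - v) < 0 := by
    by_contra! h
    refine hne (he.subset.antisymm fun x hx => hl2 x hx (le_antisymm (hl1 x hx) ?_))
    have := map_le_of_mem_convexHull (-l) (c := -l v)
      (fun y hy => by
        have := h y hy
        rw [map_sub] at this
        rw [LinearMap.neg_apply]
        linarith) hx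
    rw [LinearMap.neg_apply] at this
    rw [map_sub]
    linarith
  obtain ⟨l', w, hd, hlw, hw, hlu⟩ := exists_rotation_functional hE l (hl q hq) hu
  have hle : ∀ y ∈ e, l' (y - v) = 0 := fun y hy => by
    have h1 : vectorSpan ℝ e ≤ LinearMap.ker l' := hsp.trans (by
      rw [Submodule.span_singleton_le_iff_mem]; exact hd)
    exact h1 (vsub_mem_vectorSpan ℝ hy hv)
  -- Tilt the supporting plane about the edge until it first meets another point of `V`: `y₀`
  -- minimizes the parameter at which `l + t • l'` vanishes on `y - v`.
  obtain ⟨y₀, hy₀, hmin⟩ := (hV.toFinset.filter fun y => 0 < l' (y - v)).exists_min_image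
    (fun y => -l (y - v) / l' (y - v)) ⟨u, by simp [huV, -map_sub, hlu]⟩
  simp only [Finset.mem_filter, Set.Finite.mem_toFinset] at hy₀ hmin
  have hy₀l : l (y₀ - v) < 0 := lt_of_le_of_ne (hl1 _ (subset_convexHull ℝ V hy₀.1)) fun h => by
    have := hle _ (hl2 _ (subset_convexHull ℝ V hy₀.1) h)
    linarith [hy₀.2]
  set t := -l (y₀ - v) / l' (y₀ - v) with ht
  have htpos : 0 < t := div_pos (by linarith) hy₀.2
  let m := l + t • l'
  have hm : ∀ z, m z = l z + t * l' z := fun z => by simp [m]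
  have hmV : ∀ y ∈ V, m y ≤ m v := fun y hy => by
    suffices m (y - v) ≤ 0 by rw [map_sub] at this; linarith
    rw [hm]
    have h1 := hl1 y (subset_convexHull ℝ V hy)
    rcases le_or_gt (l' (y - v)) 0 with h | h
    · linarith [mul_nonpos_of_nonneg_of_nonpos htpos.le h]
    · have := hmin y ⟨hy, h⟩
      rw [le_div_iff₀ h] at this
      linarith
  have hmP : ∀ y ∈ convexHull ℝ V, m y ≤ m v := fun y hy => map_le_of_mem_convexHull m hmV hy
  have hG := exposed_of_linear (A := convexHull ℝ V) m
  set G := {x ∈ convexHull ℝ V | ∀ y ∈ convexHull ℝ V, m y ≤ m x} with hGdef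
  have memG : ∀ y ∈ convexHull ℝ V, m (y - v) = 0 → y ∈ G := fun y hy h =>
    ⟨hy, fun z hz => by rw [map_sub] at h; linarith [hmP z hz]⟩
  have heG : e ⊆ G := fun y hy => memG y (he.subset hy) (by rw [hm, hl y hy, hle y hy]; simp)
  have hvG : v ∈ G := heG hv
  have hyG : y₀ ∈ G := memG _ (subset_convexHull ℝ V hy₀.1) (by
    rw [hm, ht, div_mul_cancel₀ _ hy₀.2.ne']; ring)
  refine ⟨G, hG, le_antisymm ?_ ?_, heG⟩
  · have hmw : m w ≠ 0 := by
      rw [hm, hlw, zero_add]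
      exact mul_ne_zero htpos.ne' hw
    have := finrank_ker_of_ne_zero m hmw
    have h2 : vectorSpan ℝ G ≤ LinearMap.ker m := by
      rw [vectorSpan_eq_span_vsub_set_right ℝ hvG, Submodule.span_le]
      rintro _ ⟨x, hx, rfl⟩
      have a1 := hx.2 v hvG.1
      have a2 := hvG.2 x hx.1
      simp only [vsub_eq_sub, SetLike.mem_coe, LinearMap.mem_ker, map_sub]
      linarith
    have := Submodule.finrank_mono h2
    omega
  -- The new contact point `y₀` lies in `G` but not in `e`, so the dimension rises.
  · by_contra! h
    have heq : e = G := he.eq_of_subset hG heG ⟨v, hv⟩ (by omega)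
    have := hl y₀ (heq ▸ hyG)
    linarith

theorem IsExposed.eq_convexHull_extremePoints {V F : Set E} (hV : V.Finite)
    (hF : IsExposed ℝ (convexHull ℝ V) F) : F = convexHull ℝ (F.extremePoints ℝ) := by
  have hc : Convex ℝ F := hF.convex (convex_convexHull ℝ V)
  have hcomp : IsCompact F := hF.isCompact (Set.Finite.isCompact_convexHull (𝕜 := ℝ) hV)
  have hfin : (F.extremePoints ℝ).Finite := hV.subset
    (hF.isExtreme.extremePoints_subset_extremePoints.trans extremePoints_convexHull_subset)
  conv_lhs => rw [← closure_convexHull_extremePoints hcomp hc]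
  exact (Set.Finite.isClosed_convexHull (𝕜 := ℝ) hfin).closure_eq

/-- A face survives the deletion of points that are not vertices of it. -/
theorem IsExposed.of_extremePoints_subset {V V' F : Set E} (hV : V.Finite) (hVV : V' ⊆ V)
    (hF : IsExposed ℝ (convexHull ℝ V) F) (hext : F.extremePoints ℝ ⊆ V') :
    IsExposed ℝ (convexHull ℝ V') F := by
  intro hne
  have hsub : F ⊆ convexHull ℝ V' := by
    rw [hF.eq_convexHull_extremePoints hV]
    exact convexHull_mono hext
  obtain ⟨f, hf⟩ := hne
  obtain ⟨l, hl⟩ := hF ⟨f, hf⟩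
  refine ⟨l, Set.Subset.antisymm (fun x hx => ⟨hsub hx, fun y hy => ?_⟩) fun x hx => ?_⟩
  · rw [hl] at hx
    exact hx.2 y (convexHull_mono hVV hy)
  · have hlf := hx.2 f (hsub hf)
    rw [hl] at hf ⊢
    exact ⟨convexHull_mono hVV hx.1, fun y hy => (hf.2 y hy).trans hlf⟩

/-- The face is the hull of its extreme points, and `k` points span dimension at most `k - 1`. Thus
a facet has at least three vertices. -/
theorem IsExposed.finrank_lt_ncard_extremePoints {V F : Set E} (hV : V.Finite)
    (hF : IsExposed ℝ (convexHull ℝ V) F) (hne : F.Nonempty) :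
    Module.finrank ℝ (vectorSpan ℝ F) < (F.extremePoints ℝ).ncard := by
  classical
  have hfin : (F.extremePoints ℝ).Finite := hV.subset
    (hF.isExtreme.extremePoints_subset_extremePoints.trans extremePoints_convexHull_subset)
  have heq := hF.eq_convexHull_extremePoints hV
  have hne' : (F.extremePoints ℝ).Nonempty := by
    rw [heq] at hne
    exact convexHull_nonempty_iff.1 hne
  have hpos := (Set.ncard_pos hfin).2 hne'
  have h1 := finrank_vectorSpan_image_finset_le ℝ (id : E → E) hfin.toFinset
    (n := (F.extremePoints ℝ).ncard - 1) (by rw [← Set.ncard_eq_toFinset_card _ hfin]; omega)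
  rw [Finset.image_id, Set.Finite.coe_toFinset] at h1
  have h2 : vectorSpan ℝ F = vectorSpan ℝ (F.extremePoints ℝ) := by
    conv_lhs => rw [heq]
    rw [← direction_affineSpan, affineSpan_convexHull, direction_affineSpan]
  rw [h2]
  omega

end ExposedFaces

/-! ### Linear bound on face-vertex incidences -/

/-- The incidences between the hull faces of `V` and their vertices. -/
def faceVertexPairs (V : Set Point3) : Set (Set Point3 × Point3) :=
  {p | p.1 ∈ hullFaces V ∧ p.2 ∈ p.1.extremePoints ℝ}

/-- The incidences between the hull faces of `V` of dimension `d` and their vertices. -/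
def faceVertexPairsOfDim (V : Set Point3) (d : ℕ) : Set (Set Point3 × Point3) :=
  {p ∈ faceVertexPairs V | Module.finrank ℝ (vectorSpan ℝ p.1) = d}

theorem extremePoints_hullFace {V F : Set Point3} (hF : F ∈ hullFaces V) :
    F.extremePoints ℝ = F ∩ (convexHull ℝ V).extremePoints ℝ :=
  hF.2.1.isExtreme.extremePoints_eq

theorem extremePoints_hullFace_subset {V F : Set Point3} (hF : F ∈ hullFaces V) :
    F.extremePoints ℝ ⊆ V := by
  rw [extremePoints_hullFace hF]
  exact Set.inter_subset_right.trans extremePoints_convexHull_subset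

theorem faceVertexPairs_finite {V : Set Point3} (hV : V.Finite) : (faceVertexPairs V).Finite :=
  ((hullFaces_finite hV).prod hV).subset fun _ hp => ⟨hp.1, extremePoints_hullFace_subset hp.1 hp.2⟩

theorem faceVertexPairsOfDim_finite {V : Set Point3} (hV : V.Finite) (d : ℕ) :
    (faceVertexPairsOfDim V d).Finite :=
  (faceVertexPairs_finite hV).subset fun _ hp => hp.1

theorem ncard_faceVertexPairsOfDim_zero_le {V : Set Point3} (hV : V.Finite) :
    (faceVertexPairsOfDim V 0).ncard ≤ V.ncard := by
  have key : ∀ p ∈ faceVertexPairsOfDim V 0, p.1 = {p.2} := by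
    rintro ⟨F, v⟩ ⟨⟨-, hv⟩, hd⟩
    have hv' : v ∈ F := hv.1
    refine (Set.singleton_subset_iff.2 hv').antisymm' fun q hq => ?_
    have := vsub_mem_vectorSpan ℝ hq hv'
    rw [Submodule.finrank_eq_zero] at hd
    rw [hd, Submodule.mem_bot, vsub_eq_sub, sub_eq_zero] at this
    exact this
  refine Set.ncard_le_ncard_of_injOn Prod.snd
    (fun p hp => extremePoints_hullFace_subset hp.1.1 hp.1.2) (fun p hp q hq h => ?_) hV
  refine Prod.ext ?_ h
  rw [key p hp, key q hq]
  exact congrArg _ h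

theorem exists_linear_injOn {V : Set Point3} (hV : V.Finite) :
    ∃ x : Point3 →ₗ[ℝ] ℝ, Set.InjOn x V := by
  have := hV.to_subtype
  obtain ⟨x, hx⟩ := Module.exists_dual_forall_apply_ne_zero (K := ℝ)
    (fun p : {p : V × V // p.1 ≠ p.2} => (p.1.1 : Point3) - p.1.2)
    fun p => sub_ne_zero.2 fun h => p.2 (Subtype.ext h)
  refine ⟨x, fun a ha b hb hab => ?_⟩
  by_contra hne
  refine hx ⟨(⟨a, ha⟩, ⟨b, hb⟩), fun h => hne (congrArg Subtype.val h)⟩ ?_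
  simp [hab]

open Classical in
theorem ncard_faceVertexPairsOfDim_two_le {V : Set Point3} (hV : V.Finite) :
    (faceVertexPairsOfDim V 2).ncard ≤ 6 * V.ncard := by
  obtain ⟨x, hx⟩ := exists_linear_injOn hV
  have hfin := faceVertexPairsOfDim_finite hV 2
  set s := hfin.toFinset with hs
  -- Incidences whose vertex is neither lowest nor highest in its facet.
  set B := s.filter (fun p => (∃ a ∈ p.1, x a < x p.2) ∧ ∃ b ∈ p.1, x p.2 < x b) with hB
  have mem_s : ∀ p, p ∈ s ↔ p ∈ faceVertexPairsOfDim V 2 := fun p => by simp [hs]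
  have hBV : B.card ≤ 2 * hV.toFinset.card := by
    refine Finset.card_le_mul_card_image_of_maps_to (f := Prod.snd) (fun p hp => ?_) 2
      fun v _ => ?_
    · rw [hV.mem_toFinset]
      have := (mem_s p).1 (Finset.mem_filter.1 hp).1
      exact extremePoints_hullFace_subset this.1.1 this.1.2
    · by_contra! h
      obtain ⟨p, hp, q, hq, r, hr, hpq, hpr, hqr⟩ := Finset.two_lt_card.1 h
      have hall : ∀ i, ![p, q, r] i ∈ B ∧ (![p, q, r] i).2 = v := by
        intro i
        fin_cases i
        exacts [Finset.mem_filter.1 hp, Finset.mem_filter.1 hq, Finset.mem_filter.1 hr]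
      have hinj : ∀ i j, i ≠ j → ![p, q, r] i ≠ ![p, q, r] j := by
        intro i j hij
        fin_cases i <;> fin_cases j <;> simp_all [eq_comm]
      have hmem : ∀ i, ![p, q, r] i ∈ faceVertexPairsOfDim V 2 := fun i =>
        (mem_s _).1 (Finset.mem_filter.1 (hall i).1).1
      have hlh : ∀ i, (∃ a ∈ (![p, q, r] i).1, x a < x v) ∧ ∃ b ∈ (![p, q, r] i).1, x v < x b :=
        fun i => (hall i).2 ▸ (Finset.mem_filter.1 (hall i).1).2
      have hvi : ∀ i, v ∈ (![p, q, r] i).1 ∩ (convexHull ℝ V).extremePoints ℝ := fun i => by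
        rw [← extremePoints_hullFace (hmem i).1.1]
        exact (hall i).2 ▸ (hmem i).1.2
      have hker : Module.finrank ℝ (LinearMap.ker x) ≤ 2 := by
        obtain ⟨a, -, ha⟩ := (hlh 0).1
        have := finrank_ker_of_ne_zero x (w := a - v) (by rw [map_sub]; linarith)
        rw [finrank_euclideanSpace_fin] at this
        omega
      refine not_three_facets_nonextremal (convex_convexHull ℝ V) (hvi 0).2 x hker
        (fun i => (![p, q, r] i).1) (fun i => (hmem i).1.1.2.1) (fun i => (hmem i).2)
        (fun i => (hvi i).1) (fun i => (hlh i).1) (fun i => (hlh i).2) fun i j hij h => ?_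
      exact hinj i j hij (Prod.ext h ((hall i).2.trans (hall j).2.symm))
  have hsB : s.card ≤ 3 * B.card := by
    rw [Finset.card_eq_sum_card_image Prod.fst s, Finset.card_eq_sum_card_fiberwise
      (f := Prod.fst) (s := B) (t := s.image Prod.fst) fun p hp =>
        Finset.mem_image_of_mem _ (Finset.mem_filter.1 hp).1, Finset.mul_sum]
    refine Finset.sum_le_sum fun F hF => ?_
    obtain ⟨p, hp, rfl⟩ := Finset.mem_image.1 hF
    obtain ⟨⟨hpF, -⟩, hd⟩ := (mem_s p).1 hp
    set T := s.filter (fun q => q.1 = p.1) with hT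
    have hTcard : 3 ≤ T.card := by
      have h1 := hpF.2.1.finrank_lt_ncard_extremePoints hV hpF.1
      rw [hd] at h1
      refine h1.trans_le ?_
      rw [← Set.ncard_coe_finset]
      refine Set.ncard_le_ncard_of_injOn (fun v => (p.1, v)) (fun v hv => ?_)
        (fun v _ w _ h => (Prod.ext_iff.1 h).2)
      simp only [hT, Finset.coe_filter, Set.mem_ofPred_eq, and_true]
      exact (mem_s _).2 ⟨⟨hpF, hv⟩, hd⟩
    have hTne : T.Nonempty := Finset.card_pos.1 (by omega)
    obtain ⟨u, hu, humin⟩ := T.exists_min_image (fun q => x q.2) hTne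
    obtain ⟨w, hw, hwmax⟩ := T.exists_max_image (fun q => x q.2) hTne
    have hTV : ∀ q ∈ T, q.2 ∈ V ∧ q.2 ∈ p.1 ∧ q.1 = p.1 := fun q hq => by
      obtain ⟨hqs, hqp⟩ := Finset.mem_filter.1 hq
      have := (mem_s q).1 hqs
      exact ⟨extremePoints_hullFace_subset this.1.1 this.1.2, hqp ▸ this.1.2.1, hqp⟩
    have hsep : ∀ q ∈ T, ∀ r ∈ T, q ≠ r → x q.2 ≠ x r.2 := fun q hq r hr hne h =>
      hne (Prod.ext ((hTV q hq).2.2.trans (hTV r hr).2.2.symm) (hx (hTV q hq).1 (hTV r hr).1 h))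
    -- Only the lowest and the highest vertex are lost, and `k ≤ 3 * (k - 2)` for `k ≥ 3`.
    have hsub : (T.erase u).erase w ⊆ B.filter (fun q => q.1 = p.1) := by
      intro q hq
      simp only [Finset.mem_erase] at hq
      obtain ⟨hqw, hqu, hqT⟩ := hq
      have hqp := (hTV q hqT).2.2
      refine Finset.mem_filter.2 ⟨Finset.mem_filter.2 ⟨(Finset.mem_filter.1 hqT).1,
        ⟨u.2, hqp ▸ (hTV u hu).2.1, ?_⟩, w.2, hqp ▸ (hTV w hw).2.1, ?_⟩, hqp⟩
      · exact lt_of_le_of_ne (humin q hqT) (hsep u hu q hqT hqu.symm)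
      · exact lt_of_le_of_ne (hwmax q hqT) (hsep q hqT w hw hqw)
    have h1 := Finset.card_le_card hsub
    have h2 := Finset.pred_card_le_card_erase (s := T) (a := u)
    have h3 := Finset.pred_card_le_card_erase (s := T.erase u) (a := w)
    omega
  rw [Set.ncard_eq_toFinset_card _ hfin, ← hs, Set.ncard_eq_toFinset_card _ hV]
  omega

open Classical in
-- Send each edge to a facet containing it; a facet-vertex pair is hit at most twice, which gives `2
-- * 6`. The remaining 1 covers a hull that is itself a segment.
theorem ncard_faceVertexPairsOfDim_one_le {V : Set Point3} (hV : V.Finite) :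
    (faceVertexPairsOfDim V 1).ncard ≤ 13 * V.ncard := by
  have hfin := faceVertexPairsOfDim_finite hV 1
  set s := hfin.toFinset with hs
  have mem_s : ∀ p, p ∈ s ↔ p ∈ faceVertexPairsOfDim V 1 := fun p => by simp [hs]
  have h1 : (s.filter fun p => p.1 = convexHull ℝ V).card ≤ hV.toFinset.card := by
    refine Finset.card_le_card_of_injOn Prod.snd (fun p hp => ?_) fun p hp q hq h => ?_
    · have := (mem_s p).1 (Finset.mem_filter.1 hp).1
      exact hV.mem_toFinset.2 (extremePoints_hullFace_subset this.1.1 this.1.2)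
    · exact Prod.ext ((Finset.mem_filter.1 hp).2.trans (Finset.mem_filter.1 hq).2.symm) h
  have h2 : (s.filter fun p => p.1 ≠ convexHull ℝ V).card ≤
      2 * (faceVertexPairsOfDim_finite hV 2).toFinset.card := by
    have hex : ∀ p ∈ s.filter fun p => p.1 ≠ convexHull ℝ V, ∃ G,
        IsExposed ℝ (convexHull ℝ V) G ∧ Module.finrank ℝ (vectorSpan ℝ G) = 2 ∧ p.1 ⊆ G := by
      intro p hp
      obtain ⟨hp, hne⟩ := Finset.mem_filter.1 hp
      have hp' := (mem_s p).1 hp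
      exact exists_facet_of_edge finrank_euclideanSpace_fin hV hp'.1.1.2.1 hp'.2 hne
    choose! G hG hG2 hsub using hex
    refine Finset.card_le_mul_card_image_of_maps_to (f := fun p => (G p, p.2)) (fun p hp => ?_) 2
      fun v _ => ?_
    · have hp' := (mem_s p).1 (Finset.mem_filter.1 hp).1
      have hv := hsub p hp hp'.1.2.1
      have hGV : G p ∈ hullFaces V := ⟨⟨_, hv⟩, hG p hp, (hG2 p hp).le⟩
      refine (Set.Finite.mem_toFinset _).2 ⟨⟨hGV, ?_⟩, hG2 p hp⟩
      rw [extremePoints_hullFace hGV]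
      have := hp'.1.2
      rw [extremePoints_hullFace hp'.1.1] at this
      exact ⟨hv, this.2⟩
    · by_contra! h
      obtain ⟨p, hp, q, hq, r, hr, hpq, hpr, hqr⟩ := Finset.two_lt_card.1 h
      have hall : ∀ i, ![p, q, r] i ∈ (s.filter fun p => p.1 ≠ convexHull ℝ V) ∧
          (G (![p, q, r] i), (![p, q, r] i).2) = v := by
        intro i
        fin_cases i
        exacts [Finset.mem_filter.1 hp, Finset.mem_filter.1 hq, Finset.mem_filter.1 hr]
      have hinj : ∀ i j, i ≠ j → ![p, q, r] i ≠ ![p, q, r] j := by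
        intro i j hij
        fin_cases i <;> fin_cases j <;> simp_all [eq_comm]
      have hmem : ∀ i, ![p, q, r] i ∈ faceVertexPairsOfDim V 1 := fun i =>
        (mem_s _).1 (Finset.mem_filter.1 (hall i).1).1
      have hv1 : ∀ i, G (![p, q, r] i) = v.1 := fun i => congrArg Prod.fst (hall i).2
      have hv2 : ∀ i, (![p, q, r] i).2 = v.2 := fun i => (Prod.ext_iff.1 (hall i).2).2
      refine not_three_edges_in_plane (A := convexHull ℝ V) (G := v.1)
        (by rw [← hv1 0]; exact (hG2 _ (hall 0).1).le) (v := v.2)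
        (fun i => (![p, q, r] i).1) (fun i => (hmem i).1.1.2.1) (fun i => (hmem i).2)
        (fun i => by rw [← hv2 i]; exact (hmem i).1.2.1)
        (fun i => by rw [← hv1 i]; exact hsub _ (hall i).1) fun i j hij h => ?_
      exact hinj i j hij (Prod.ext h ((hv2 i).trans (hv2 j).symm))
  have h3 := ncard_faceVertexPairsOfDim_two_le hV
  have h4 := Finset.card_filter_add_card_filter_not (s := s) (fun p => p.1 = convexHull ℝ V)
  rw [Set.ncard_eq_toFinset_card _ (faceVertexPairsOfDim_finite hV 2),
    Set.ncard_eq_toFinset_card _ hV] at h3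
  rw [Set.ncard_eq_toFinset_card _ hfin, ← hs, Set.ncard_eq_toFinset_card _ hV]
  simp only [ne_eq] at h2
  omega

/-- A polytope in three-dimensional space has linearly many face-vertex incidences. -/
theorem ncard_faceVertexPairs_le {V : Set Point3} (hV : V.Finite) :
    (faceVertexPairs V).ncard ≤ 20 * V.ncard := by
  have hsub : faceVertexPairs V ⊆
      faceVertexPairsOfDim V 0 ∪ faceVertexPairsOfDim V 1 ∪ faceVertexPairsOfDim V 2 := by
    intro p hp
    have h2 := hp.1.2.2
    have : Module.finrank ℝ (vectorSpan ℝ p.1) = 0 ∨ Module.finrank ℝ (vectorSpan ℝ p.1) = 1 ∨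
        Module.finrank ℝ (vectorSpan ℝ p.1) = 2 := by omega
    rcases this with h | h | h
    exacts [.inl (.inl ⟨hp, h⟩), .inl (.inr ⟨hp, h⟩), .inr ⟨hp, h⟩]
  -- The constant is `20 = 1 + 13 + 6`.
  have h0 := ncard_faceVertexPairsOfDim_zero_le hV
  have h1 := ncard_faceVertexPairsOfDim_one_le hV
  have h2 := ncard_faceVertexPairsOfDim_two_le hV
  have := Set.ncard_le_ncard hsub (((faceVertexPairsOfDim_finite hV 0).union
    (faceVertexPairsOfDim_finite hV 1)).union (faceVertexPairsOfDim_finite hV 2))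
  have h3 := Set.ncard_union_le (faceVertexPairsOfDim V 0 ∪ faceVertexPairsOfDim V 1)
    (faceVertexPairsOfDim V 2)
  have h4 := Set.ncard_union_le (faceVertexPairsOfDim V 0) (faceVertexPairsOfDim V 1)
  omega

/-! ### Creations versus destructions, and symmetry of random orders -/

/-- For a sequence of finite sets that starts with the empty set, at most as many elements are
destroyed as are created. -/
theorem sum_ncard_symmDiff_le {α : Type*} (F : ℕ → Set α) (hF : ∀ i, (F i).Finite)
    (h0 : F 0 = ∅) (k : ℕ) :
    ∑ i ∈ Finset.range k, (F i ∆ F (i + 1)).ncard ≤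
      2 * ∑ i ∈ Finset.range k, (F (i + 1) \ F i).ncard := by
  -- Creations minus destructions telescope to the size of `F k`, so an exact identity is available
  -- for induction.
  suffices h : ∑ i ∈ Finset.range k, (F i ∆ F (i + 1)).ncard + (F k).ncard =
      2 * ∑ i ∈ Finset.range k, (F (i + 1) \ F i).ncard by omega
  induction k with
  | zero => simp [h0]
  | succ k ih =>
    rw [Finset.sum_range_succ, Finset.sum_range_succ, mul_add, ← ih]
    have h1 : (F k ∆ F (k + 1)).ncard = (F k \ F (k + 1)).ncard + (F (k + 1) \ F k).ncard := by
      rw [Set.symmDiff_def]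
      exact Set.ncard_union_eq disjoint_sdiff_sdiff (hF k).sdiff (hF (k + 1)).sdiff
    have h2 := Set.ncard_sdiff_add_ncard (F k) (F (k + 1)) (hF k) (hF (k + 1))
    have h3 := Set.ncard_sdiff_add_ncard (F (k + 1)) (F k) (hF (k + 1)) (hF k)
    rw [Set.union_comm] at h3
    omega

theorem sum_perm_apply_eq {m : ℕ} (f : Equiv.Perm (Fin m) → Fin m → ℕ) (i j : Fin m)
    (hf : ∀ σ, f (σ * Equiv.swap i j) i = f σ j) : ∑ σ, f σ i = ∑ σ, f σ j := by
  rw [← Equiv.sum_comp (Equiv.mulRight (Equiv.swap i j))]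
  exact Finset.sum_congr rfl fun σ _ => hf σ

/-! ### Color classes and backwards analysis -/

section Colors

variable {m : ℕ} (S : Finset Point3) (color : S → Fin m)

open Classical in
/-- The points of color `c`. -/
noncomputable def colorClass (c : Fin m) : Finset Point3 :=
  S.filter fun p => ∃ h : p ∈ S, color ⟨p, h⟩ = c

variable {S color}

theorem mem_colorClass {c : Fin m} {p : Point3} :
    p ∈ colorClass S color c ↔ ∃ h : p ∈ S, color ⟨p, h⟩ = c := by
  simp only [colorClass, Finset.mem_filter, and_iff_right_iff_imp]
  exact fun ⟨h, _⟩ => h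

theorem colorClass_eq_of_mem {c d : Fin m} {p : Point3} (hc : p ∈ colorClass S color c)
    (hd : p ∈ colorClass S color d) : c = d := by
  obtain ⟨h, rfl⟩ := mem_colorClass.1 hc
  obtain ⟨h', rfl⟩ := mem_colorClass.1 hd
  rfl

theorem sum_card_colorClass_filter_le {α : Type*} (T : Finset α) (g : α → Point3)
    (J : Finset (Fin m)) (σ : Equiv.Perm (Fin m))
    [∀ j, DecidablePred fun p => g p ∈ colorClass S color (σ j)] :
    ∑ j ∈ J, (T.filter fun p => g p ∈ colorClass S color (σ j)).card ≤ T.card := by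
  classical
  rw [← Finset.card_biUnion]
  · exact Finset.card_le_card (Finset.biUnion_subset.2 fun j _ => Finset.filter_subset _ _)
  · intro j _ k _ hjk
    refine Finset.disjoint_left.2 fun p hp hp' => hjk (σ.injective ?_)
    exact colorClass_eq_of_mem (Finset.mem_filter.1 hp).2 (Finset.mem_filter.1 hp').2

theorem sum_card_colorClass_le (σ : Equiv.Perm (Fin m)) :
    ∑ j, (colorClass S color (σ j)).card ≤ S.card := by
  classical
  refine le_trans (Finset.sum_le_sum fun j _ => Finset.card_le_card fun p hp => ?_)
    (sum_card_colorClass_filter_le S id Finset.univ σ (color := color))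
  exact Finset.mem_filter.2 ⟨(mem_colorClass.1 hp).1, hp⟩

theorem pointsOfFirstColors_eq (σ : Equiv.Perm (Fin m)) (i : ℕ) :
    pointsOfFirstColors S color σ i =
      {p | ∃ j : Fin m, (j : ℕ) < i ∧ p ∈ colorClass S color (σ j)} := by
  ext p
  constructor
  · rintro ⟨h, j, hj, hc⟩
    exact ⟨j, hj, mem_colorClass.2 ⟨h, hc.symm⟩⟩
  · rintro ⟨j, hj, hp⟩
    obtain ⟨h, hc⟩ := mem_colorClass.1 hp
    exact ⟨h, j, hj, hc.symm⟩

theorem pointsOfFirstColors_finite (σ : Equiv.Perm (Fin m)) (i : ℕ) :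
    (pointsOfFirstColors S color σ i).Finite :=
  S.finite_toSet.subset fun _ hp => hp.1

/-- The swap only permutes positions up to `i`. This invariance is what makes the last color
exchangeable with any earlier one. -/
theorem pointsOfFirstColors_mul_swap (σ : Equiv.Perm (Fin m)) {i j : Fin m} (hji : j ≤ i) :
    pointsOfFirstColors S color (σ * Equiv.swap i j) (i + 1) =
      pointsOfFirstColors S color σ (i + 1) := by
  have key : ∀ k : Fin m, (k : ℕ) < i + 1 → (Equiv.swap i j k : ℕ) < i + 1 := fun k hk => by
    have hji' : (j : ℕ) ≤ i := hji
    rw [Equiv.swap_apply_def]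
    split_ifs <;> omega
  rw [pointsOfFirstColors_eq, pointsOfFirstColors_eq]
  ext p
  constructor
  · rintro ⟨k, hk, hp⟩
    exact ⟨_, key k hk, hp⟩
  · rintro ⟨k, hk, hp⟩
    exact ⟨_, key k hk, by simpa using hp⟩

theorem ncard_pointsOfFirstColors_le (σ : Equiv.Perm (Fin m)) (i : Fin m) :
    (pointsOfFirstColors S color σ (i + 1)).ncard ≤
      ∑ j ∈ Finset.Iic i, (colorClass S color (σ j)).card := by
  classical
  refine le_trans ?_ Finset.card_biUnion_le
  rw [← Set.ncard_coe_finset]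
  refine Set.ncard_le_ncard (fun p hp => ?_) (Finset.finite_toSet _)
  rw [pointsOfFirstColors_eq] at hp
  obtain ⟨j, hj, hp⟩ := hp
  exact Finset.mem_coe.2 (Finset.mem_biUnion.2
    ⟨j, Finset.mem_Iic.2 (Fin.le_def.2 (Nat.lt_succ_iff.1 hj)), hp⟩)

variable (S color) in
open Classical in
/-- The incidences of the hull of the colors up to position `i` whose vertex has the color at
position `j`. -/
noncomputable def pairsOfColor (i : Fin m) (σ : Equiv.Perm (Fin m)) (j : Fin m) :
    Finset (Set Point3 × Point3) :=
  (faceVertexPairs_finite (pointsOfFirstColors_finite (S := S) (color := color) σ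
    (i + 1))).toFinset.filter fun p => p.2 ∈ colorClass S color (σ j)

/-- Every face created by inserting a color class has a vertex of that color. -/
theorem ncard_created_le (σ : Equiv.Perm (Fin m)) (i : Fin m) :
    (hullFaces (pointsOfFirstColors S color σ (i + 1)) \
      hullFaces (pointsOfFirstColors S color σ i)).ncard ≤ (pairsOfColor S color i σ i).card := by
  classical
  refine le_trans ?_ (Finset.card_image_le (f := Prod.fst))
  rw [← Set.ncard_coe_finset]
  refine Set.ncard_le_ncard ?_ (Finset.finite_toSet _)
  rintro F ⟨hF, hF'⟩
  -- If all vertices were old, the face would survive deletion of the new class and so not be new.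
  obtain ⟨v, hv, hvi⟩ : ∃ v ∈ F.extremePoints ℝ, v ∉ pointsOfFirstColors S color σ i := by
    by_contra! h
    exact hF' ⟨hF.1, hF.2.1.of_extremePoints_subset (pointsOfFirstColors_finite σ _)
      (fun p ⟨hp, j, hj, hc⟩ => ⟨hp, j, hj.trans (Nat.lt_succ_self _), hc⟩) h, hF.2.2⟩
  have hvV := extremePoints_hullFace_subset hF hv
  rw [pointsOfFirstColors_eq] at hvi hvV
  obtain ⟨j, hj, hvj⟩ := hvV
  obtain rfl : j = i := by
    by_contra hne
    exact hvi ⟨j, lt_of_le_of_ne (Nat.lt_succ_iff.1 hj) fun h => hne (Fin.ext h), hvj⟩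
  refine Finset.mem_coe.2 (Finset.mem_image.2 ⟨(F, v), Finset.mem_filter.2 ⟨?_, hvj⟩, rfl⟩)
  exact (Set.Finite.mem_toFinset _).2 ⟨hF, hv⟩

theorem card_pairsOfColor_mul_swap (σ : Equiv.Perm (Fin m)) {i j : Fin m} (hji : j ≤ i) :
    (pairsOfColor S color i (σ * Equiv.swap i j) i).card = (pairsOfColor S color i σ j).card := by
  congr 1
  ext p
  simp [pairsOfColor, pointsOfFirstColors_mul_swap σ hji]

/-- Backwards analysis: the last of the first `i + 1` colors is equally likely to be any of them. -/
theorem sum_card_pairsOfColor_le (i : Fin m) :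
    ∑ σ, (pairsOfColor S color i σ i).card ≤
      20 * ∑ σ : Equiv.Perm (Fin m), (colorClass S color (σ i)).card := by
  classical
  -- Multiplying by `i + 1` replaces the average over positions `j ≤ i` by a sum, on both sides.
  refine Nat.le_of_mul_le_mul_left (c := (i : ℕ) + 1) ?_ (Nat.succ_pos _)
  calc ((i : ℕ) + 1) * ∑ σ, (pairsOfColor S color i σ i).card
      = ∑ j ∈ Finset.Iic i, ∑ σ, (pairsOfColor S color i σ j).card := by
        rw [Finset.sum_congr rfl fun j hj => (sum_perm_apply_eq
          (fun σ j => (pairsOfColor S color i σ j).card) i j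
            fun σ => card_pairsOfColor_mul_swap σ (Finset.mem_Iic.1 hj)).symm]
        rw [Finset.sum_const, Fin.card_Iic, smul_eq_mul]
    _ = ∑ σ, ∑ j ∈ Finset.Iic i, (pairsOfColor S color i σ j).card := Finset.sum_comm
    _ ≤ ∑ σ : Equiv.Perm (Fin m), 20 * ∑ j ∈ Finset.Iic i, (colorClass S color (σ j)).card := by
        refine Finset.sum_le_sum fun σ _ => ?_
        have hV := pointsOfFirstColors_finite (S := S) (color := color) σ (i + 1)
        refine (sum_card_colorClass_filter_le _ Prod.snd _ σ).trans ?_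
        rw [← Set.ncard_eq_toFinset_card _ (faceVertexPairs_finite hV)]
        exact (ncard_faceVertexPairs_le hV).trans
          (Nat.mul_le_mul_left _ (ncard_pointsOfFirstColors_le σ i))
    _ = 20 * ∑ j ∈ Finset.Iic i, ∑ σ : Equiv.Perm (Fin m), (colorClass S color (σ j)).card := by
        rw [← Finset.mul_sum, Finset.sum_comm]
    _ = ((i : ℕ) + 1) * (20 * ∑ σ : Equiv.Perm (Fin m), (colorClass S color (σ i)).card) := by
        rw [Finset.sum_congr rfl fun j _ => (sum_perm_apply_eq
          (fun σ j => (colorClass S color (σ j)).card) i j fun σ => by simp).symm]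
        rw [Finset.sum_const, Fin.card_Iic, smul_eq_mul]
        ring

theorem totalStructuralChanges_le (σ : Equiv.Perm (Fin m)) :
    totalStructuralChanges S color σ ≤ 2 * ∑ i, (pairsOfColor S color i σ i).card := by
  have h0 : hullFaces (pointsOfFirstColors S color σ 0) = ∅ := by
    rw [Set.eq_empty_iff_forall_notMem]
    rintro F ⟨⟨x, hx⟩, hF, -⟩
    have hx' := hF.subset hx
    rw [pointsOfFirstColors_eq] at hx'
    simp at hx'
  refine (sum_ncard_symmDiff_le _ (fun i => hullFaces_finite (pointsOfFirstColors_finite σ i))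
    h0 m).trans (Nat.mul_le_mul_left _ ?_)
  rw [Finset.sum_range]
  exact Finset.sum_le_sum fun i _ => ncard_created_le σ i

theorem sum_totalStructuralChanges_le :
    ∑ σ, totalStructuralChanges S color σ ≤ 40 * (Fintype.card (Equiv.Perm (Fin m)) * S.card) := by
  calc ∑ σ, totalStructuralChanges S color σ
      ≤ ∑ σ, 2 * ∑ i, (pairsOfColor S color i σ i).card :=
        Finset.sum_le_sum fun σ _ => totalStructuralChanges_le σ
    _ = 2 * ∑ i, ∑ σ, (pairsOfColor S color i σ i).card := by
        rw [← Finset.mul_sum, Finset.sum_comm]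
    _ ≤ 2 * ∑ i, 20 * ∑ σ : Equiv.Perm (Fin m), (colorClass S color (σ i)).card :=
        Nat.mul_le_mul_left _ (Finset.sum_le_sum fun i _ => sum_card_pairsOfColor_le i)
    _ = 40 * ∑ σ : Equiv.Perm (Fin m), ∑ i, (colorClass S color (σ i)).card := by
        rw [← Finset.mul_sum, Finset.sum_comm, ← mul_assoc, show 2 * 20 = 40 from rfl]
    _ ≤ 40 * ∑ _σ : Equiv.Perm (Fin m), S.card :=
        Nat.mul_le_mul_left _ (Finset.sum_le_sum fun σ _ => sum_card_colorClass_le σ)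
    _ = 40 * (Fintype.card (Equiv.Perm (Fin m)) * S.card) := by
        rw [Finset.sum_const, Finset.card_univ, smul_eq_mul]

end Colors

theorem mainTheorem7 :
    ∃ C : ℝ, ∀ (n m : ℕ) (S : Finset Point3) (color : S → Fin m), S.card = n →
      Function.Surjective color → expectedStructuralChanges S color ≤ C * n := by
  refine ⟨40, fun n m S color hn _ => ?_⟩
  subst hn
  have h : (∑ σ, (totalStructuralChanges S color σ : ℝ)) ≤
      40 * (Fintype.card (Equiv.Perm (Fin m)) * S.card) := by
    exact_mod_cast sum_totalStructuralChanges_le (S := S) (color := color)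
  have hpos : (0 : ℝ) < Fintype.card (Equiv.Perm (Fin m)) := by
    exact_mod_cast Fintype.card_pos
  rw [expectedStructuralChanges, Fintype.expect_eq_sum_div_card, div_le_iff₀ hpos]
  linarith
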